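/- Let $X,Y,Z>0$, $0<\alpha<\beta<1$ and $\phi_1,\phi_2\in(-\pi,\pi)$. For $\epsilon\ge 0$ and $u_1,u_2\in\mathbb{R}$ put $$V(\epsilon,u_1,u_2)=\exp\!\Big(-\big(Xe^{u_1}+Ye^{u_2}+Ze^{u_1+u_2}\big)-2\epsilon\big(X\cosh u_1+Y\cosh u_2+Z\cosh(u_1+u_2)\big)\Big)\,\frac{e^{\alpha u_1+\beta u_2}}{(1+e^{u_1+i\phi_1})(1+e^{u_2+i\phi_2})}.$$ Then $V(\epsilon,\cdot,\cdot)$ is integrable on $\mathbb{R}^2$ for every $\epsilon\ge 0$, the function $u\mapsto (X+Ze^{-u})^{\alpha}\exp(-Ye^{u})\,\frac{e^{\beta u}}{1+e^{u+i\phi_2}}$ is integrable on $\mathbb{R}$, and $$\int_{-\infty}^{\infty}\!\int_{-\infty}^{\infty}V(\epsilon,u_1,u_2)\,du_1\,du_2=\int_{-\infty}^{\infty}\!\int_{-\infty}^{\infty}V(0,u_1,u_2)\,du_1\,du_2+\Gamma(-\alpha)\,\epsilon^{\alpha}\int_{-\infty}^{\infty}(X+Ze^{-u})^{\alpha}\exp(-Ye^{u})\,\frac{e^{\beta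 u}}{1+e^{u+i\phi_2}}\,du+O(\epsilon^{\beta})$$ as $\epsilon\to0+$, where the constant implied by $O$ may depend on $X,Y,Z,\alpha,\beta,\phi_1,\phi_2$. -/

import Mathlib

/-- The integrand `V(ε, u₁, u₂)`, with its dependence on the parameters made explicit. -/
noncomputable def integrandV (X Y Z α β φ₁ φ₂ ε u₁ u₂ : ℝ) : ℂ :=
  ((Real.exp (-(X * Real.exp u₁ + Y * Real.exp u₂ + Z * Real.exp (u₁ + u₂))
      - 2 * ε * (X * Real.cosh u₁ + Y * Real.cosh u₂ + Z * Real.cosh (u₁ + u₂))) : ℝ) : ℂ)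
    * (((Real.exp (α * u₁ + β * u₂) : ℝ) : ℂ)
      / ((1 + Complex.exp (u₁ + Complex.I * φ₁)) * (1 + Complex.exp (u₂ + Complex.I * φ₂))))

/-- The integrand of the single integral in the coefficient of `Γ(-α) ε ^ α`. -/
noncomputable def integrandS (X Y Z α β φ u : ℝ) : ℂ :=
  (((X + Z * Real.exp (-u)) ^ α * Real.exp (-(Y * Real.exp u)) : ℝ) : ℂ)
    * (((Real.exp (β * u) : ℝ) : ℂ) / (1 + Complex.exp (u + Complex.I * φ)))

/-! Put `x = X e^{u₁} + Z e^{u₁+u₂}` and `y = Y e^{u₂}`. The ε-part of the exponent is `-(P + Q +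
R)` with `P = ε (x + y)`, `Q = ε (X + Z e^{-u₂}) e^{-u₁}` and `R = ε Y e^{-u₂}`. Removing `P` costs
`O(ε)` and removing `R` costs `O(ε^β)`, the weight in `u₂` being `e^{βu₂}`. The factor `e^{-Q}`
differs from 1 mainly as `u₁ → -∞`, where `e^{-x}` and the first denominator tend to 1. Replacing
both by 1 gives `leadingKernel`, whose `u₁`-integral is a regularised Gamma integral
(`integral_cutoffKernel`) equal to `Γ(-α) ε^α` times the single integrand.

The error of this replacement gains a factor of order `(1 + e^{u₂}) min(1, e^{u₁})`, which allows
the exponent `α` to be traded for `β`. `norm_damped_sub_le` isolates the error,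
`le_remainderMajorant` bounds it, and `integral_remainderMajorant` evaluates the bound exactly as a
combination of `ε` and `ε^β`. -/

open MeasureTheory Set Filter Topology

/-! ### Gamma integrals in exponential coordinates -/

/-- The kernel `exp (-(c e ^ u)) e ^ (s u)`, the integrand of a Gamma integral in exponential
coordinates. -/
noncomputable def gammaKernel (s c u : ℝ) : ℝ :=
  Real.exp (-(c * Real.exp u)) * Real.exp (s * u)

/-- The kernel `(1 - exp (-(c e ^ (-u)))) e ^ (s u)`, whose integral is `-Γ(-s) c ^ s`. -/
noncomputable def cutoffKernel (s c u : ℝ) : ℝ :=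
  (1 - Real.exp (-(c * Real.exp (-u)))) * Real.exp (s * u)

theorem continuous_cutoffKernel (s c : ℝ) : Continuous (cutoffKernel s c) := by
  unfold cutoffKernel; fun_prop

theorem gammaKernel_nonneg (s c u : ℝ) : 0 ≤ gammaKernel s c u := by
  unfold gammaKernel; positivity

theorem one_sub_exp_neg_nonneg {x : ℝ} (hx : 0 ≤ x) : 0 ≤ 1 - Real.exp (-x) := by
  have : Real.exp (-x) ≤ 1 := Real.exp_le_one_iff.2 (by linarith)
  linarith

theorem one_sub_exp_neg_le (x : ℝ) : 1 - Real.exp (-x) ≤ x := by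
  linarith [Real.add_one_le_exp (-x)]

theorem one_sub_exp_neg_le_one (x : ℝ) : 1 - Real.exp (-x) ≤ 1 := by
  linarith [Real.exp_pos (-x)]

theorem one_sub_exp_neg_add_le {a b : ℝ} (ha : 0 ≤ a) (hb : 0 ≤ b) :
    1 - Real.exp (-(a + b)) ≤ (1 - Real.exp (-a)) + (1 - Real.exp (-b)) := by
  rw [neg_add, Real.exp_add]
  nlinarith [mul_nonneg (one_sub_exp_neg_nonneg ha) (one_sub_exp_neg_nonneg hb)]

theorem cutoffKernel_nonneg (s u : ℝ) {c : ℝ} (hc : 0 ≤ c) : 0 ≤ cutoffKernel s c u :=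
  mul_nonneg (one_sub_exp_neg_nonneg (by positivity)) (Real.exp_pos _).le

theorem rexp_image_univ : Real.exp '' univ = Ioi 0 := by
  rw [image_univ, Real.range_exp]

/-- The substitution `x = e^u` in the Gamma integral, with Jacobian `|e^u|`. -/
theorem abs_exp_smul_gamma (s c u : ℝ) :
    |Real.exp u| • (Real.exp u ^ (s - 1) * Real.exp (-(c * Real.exp u))) = gammaKernel s c u := by
  rw [abs_of_pos (Real.exp_pos u), smul_eq_mul, ← Real.exp_mul, gammaKernel, ← mul_assoc,
    ← Real.exp_add, mul_comm]
  ring_nf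

theorem integrable_gammaKernel {s c : ℝ} (hs : 0 < s) (hc : 0 < c) :
    Integrable (gammaKernel s c) := by
  have h1 : IntegrableOn (fun x : ℝ => x ^ (s - 1) * Real.exp (-(c * x))) (Ioi 0) := by
    have := integrableOn_rpow_mul_exp_neg_mul_rpow (p := 1) (s := s - 1) (b := c) (by linarith)
      zero_lt_one hc
    simpa using this
  rw [← rexp_image_univ, integrableOn_image_iff_integrableOn_abs_deriv_smul MeasurableSet.univ
    (fun x _ => (Real.hasDerivAt_exp x).hasDerivWithinAt) Real.exp_injective.injOn] at h1
  simp only [abs_exp_smul_gamma] at h1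
  simpa using h1

theorem integral_gammaKernel {s c : ℝ} (hs : 0 < s) (hc : 0 < c) :
    ∫ u, gammaKernel s c u = (1 / c) ^ s * Real.Gamma s := by
  have h1 := Real.integral_rpow_mul_exp_neg_mul_Ioi hs hc
  rw [← rexp_image_univ, integral_image_eq_integral_abs_deriv_smul MeasurableSet.univ
    (fun x _ => (Real.hasDerivAt_exp x).hasDerivWithinAt) Real.exp_injective.injOn] at h1
  simp only [abs_exp_smul_gamma] at h1
  simpa using h1

theorem integrable_min_one_exp_mul {s : ℝ} (hs : 0 < s) (hs1 : s < 1) :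
    Integrable (fun u : ℝ => min 1 (Real.exp u) * Real.exp (-(s * u))) := by
  rw [← integrableOn_univ, ← Iic_union_Ioi (a := (0 : ℝ))]
  refine IntegrableOn.union ?_ ?_
  · refine (integrableOn_exp_mul_Iic (a := 1 - s) (by linarith) 0).congr_fun ?_ measurableSet_Iic
    intro u hu
    have : Real.exp u ≤ 1 := Real.exp_le_one_iff.2 hu
    simp only [min_eq_right this, ← Real.exp_add]
    ring_nf
  · refine (integrableOn_exp_mul_Ioi (a := -s) (by linarith) 0).congr_fun ?_ measurableSet_Ioi
    intro u hu
    have : 1 ≤ Real.exp u := Real.one_le_exp (le_of_lt hu)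
    simp only [min_eq_left this, one_mul, neg_mul]

theorem cutoffKernel_le (s u : ℝ) {c : ℝ} (hc : 0 ≤ c) :
    cutoffKernel s c u ≤ (1 + c) * (min 1 (Real.exp (-u)) * Real.exp (-(s * -u))) := by
  rw [cutoffKernel, ← mul_assoc, mul_neg, neg_neg]
  refine mul_le_mul_of_nonneg_right ?_ (Real.exp_pos _).le
  have h1 := one_sub_exp_neg_le_one (c * Real.exp (-u))
  have h2 := one_sub_exp_neg_le (c * Real.exp (-u))
  have h3 := Real.exp_pos (-u)
  rcases min_cases 1 (Real.exp (-u)) with ⟨h, _⟩ | ⟨h, _⟩ <;> rw [h] <;> nlinarith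

theorem integrable_cutoffKernel {s c : ℝ} (hs : 0 < s) (hs1 : s < 1) (hc : 0 ≤ c) :
    Integrable (cutoffKernel s c) := by
  refine ((integrable_min_one_exp_mul hs hs1).comp_neg.const_mul (1 + c)).mono'
    (continuous_cutoffKernel s c).aestronglyMeasurable (ae_of_all _ fun u => ?_)
  rw [Real.norm_of_nonneg (cutoffKernel_nonneg s u hc)]
  exact cutoffKernel_le s u hc

/-- Integration by parts reduces this to the convergent integral for `Γ(1 - s) = -s Γ(-s)`. The
boundary terms vanish at `-∞` because `s > 0` and at `+∞` because `s < 1`. -/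
theorem integral_cutoffKernel {s c : ℝ} (hs : 0 < s) (hs1 : s < 1) (hc : 0 < c) :
    ∫ u, cutoffKernel s c u = -Real.Gamma (-s) * c ^ s := by
  have hG := integrable_gammaKernel (s := 1 - s) (by linarith) hc
  have hint := integral_gammaKernel (s := 1 - s) (by linarith) hc
  rw [← integral_neg_eq_self] at hint
  have hd : ∀ u, HasDerivAt (fun u => s⁻¹ * cutoffKernel s c u)
      (cutoffKernel s c u - s⁻¹ * c * gammaKernel (1 - s) c (-u)) u := by
    intro u
    have e1 : HasDerivAt (fun u : ℝ => Real.exp (-u)) (Real.exp (-u) * -1) u :=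
      (hasDerivAt_id u).neg.exp
    have e2 : HasDerivAt (fun u : ℝ => Real.exp (s * u)) (Real.exp (s * u) * (s * 1)) u :=
      ((hasDerivAt_id u).const_mul s).exp
    have e3 := ((((e1.const_mul c).neg.exp).const_sub 1).mul e2).const_mul s⁻¹
    refine e3.congr_deriv ?_
    have : Real.exp ((1 - s) * -u) = Real.exp (-u) * Real.exp (s * u) := by
      rw [← Real.exp_add]; ring_nf
    simp only [cutoffKernel, gammaKernel, this]
    field_simp
    simp only [Pi.neg_apply]
    ring
  have hbot : Tendsto (fun u => s⁻¹ * cutoffKernel s c u) atBot (𝓝 0) := by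
    have h0 : Tendsto (fun u : ℝ => s⁻¹ * Real.exp (s * u)) atBot (𝓝 0) := by
      have := (Real.tendsto_exp_atBot.comp (tendsto_id.const_mul_atBot hs)).const_mul s⁻¹
      simpa using this
    refine squeeze_zero (fun u => mul_nonneg (by positivity) (cutoffKernel_nonneg s u hc.le))
      (fun u => ?_) h0
    gcongr
    exact mul_le_of_le_one_left (Real.exp_pos _).le (one_sub_exp_neg_le_one _)
  have htop : Tendsto (fun u => s⁻¹ * cutoffKernel s c u) atTop (𝓝 0) := by
    have h0 : Tendsto (fun u : ℝ => s⁻¹ * (c * Real.exp ((s - 1) * u))) atTop (𝓝 0) := by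
      have := ((Real.tendsto_exp_atBot.comp (tendsto_id.const_mul_atTop_of_neg
        (r := s - 1) (by linarith))).const_mul c).const_mul s⁻¹
      simpa using this
    refine squeeze_zero (fun u => mul_nonneg (by positivity) (cutoffKernel_nonneg s u hc.le))
      (fun u => ?_) h0
    gcongr
    have : Real.exp ((s - 1) * u) = Real.exp (-u) * Real.exp (s * u) := by
      rw [← Real.exp_add]; ring_nf
    rw [this, ← mul_assoc]
    exact mul_le_mul_of_nonneg_right (one_sub_exp_neg_le _) (Real.exp_pos _).le
  have hI := integrable_cutoffKernel hs hs1 hc.le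
  have hG' := hG.comp_neg.const_mul (s⁻¹ * c)
  have key := integral_of_hasDerivAt_of_tendsto hd (hI.sub hG') hbot htop
  rw [integral_sub hI hG', integral_const_mul, hint] at key
  have hΓ : Real.Gamma (1 - s) = -s * Real.Gamma (-s) := by
    rw [← Real.Gamma_add_one (by linarith : -s ≠ 0)]; ring_nf
  have hp : c * (1 / c) ^ (1 - s) = c ^ s := by
    rw [one_div, Real.inv_rpow hc.le, ← Real.rpow_neg hc.le]
    nth_rewrite 1 [← Real.rpow_one c]
    rw [← Real.rpow_add hc]; ring_nf
  rw [hΓ] at key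
  have : ∫ u, cutoffKernel s c u =
      s⁻¹ * (c * (1 / c) ^ (1 - s)) * (-s * Real.Gamma (-s)) := by linarith
  rw [this, hp]
  field_simp

/-! ### Lower bounds for the denominators -/

theorem cos_half_pos_of_mem_Ioo {φ : ℝ} (hφ : φ ∈ Ioo (-Real.pi) Real.pi) :
    0 < Real.cos (φ / 2) :=
  Real.cos_pos_of_mem_Ioo ⟨by linarith [hφ.1], by linarith [hφ.2]⟩

/-- With `r = e^u`, the squares of the two sides differ by `sin²(φ/2) (1 - r)²`. -/
theorem cos_half_mul_le_norm_one_add_exp (φ u : ℝ) :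
    Real.cos (φ / 2) * (1 + Real.exp u) ≤ ‖1 + Complex.exp (u + Complex.I * φ)‖ := by
  have hre : (1 + Complex.exp (u + Complex.I * φ)).re = 1 + Real.exp u * Real.cos φ := by
    simp [Complex.exp_re]
  have him : (1 + Complex.exp (u + Complex.I * φ)).im = Real.exp u * Real.sin φ := by
    simp [Complex.exp_im]
  rw [Complex.norm_def, Complex.normSq_apply, hre, him]
  refine Real.le_sqrt_of_sq_le ?_
  have h1 : Real.cos (φ / 2) ^ 2 = 1 / 2 + Real.cos φ / 2 := by
    rw [Real.cos_sq]; ring_nf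
  have h2 := Real.sin_sq_add_cos_sq φ
  rw [mul_pow, h1]
  nlinarith [mul_nonneg (sub_nonneg.2 (Real.cos_le_one φ)) (sq_nonneg (1 - Real.exp u))]

theorem cos_half_le_norm_one_add_exp {φ : ℝ} (hφ : φ ∈ Ioo (-Real.pi) Real.pi) (u : ℝ) :
    Real.cos (φ / 2) ≤ ‖1 + Complex.exp (u + Complex.I * φ)‖ := by
  refine le_trans ?_ (cos_half_mul_le_norm_one_add_exp φ u)
  nlinarith [cos_half_pos_of_mem_Ioo hφ, Real.exp_pos u]

theorem one_add_exp_ne_zero {φ : ℝ} (hφ : φ ∈ Ioo (-Real.pi) Real.pi) (u : ℝ) :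
    1 + Complex.exp (u + Complex.I * φ) ≠ 0 :=
  norm_pos_iff.1 ((cos_half_pos_of_mem_Ioo hφ).trans_le (cos_half_le_norm_one_add_exp hφ u))

theorem norm_exp_add_I_mul (φ u : ℝ) :
    ‖(1 + Complex.exp (u + Complex.I * φ)) - 1‖ = Real.exp u := by
  simp [Complex.norm_exp]

/-! ### Pointwise isolation of the leading part -/

/-- Splitting off the leading part of a damped exponential over a product of two denominators. -/
theorem norm_damped_sub_le {x y P Q R w r δ₁ δ₂ : ℝ} {d₁ d₂ : ℂ} (hx : 0 ≤ x)
    (hP : 0 ≤ P) (hQ : 0 ≤ Q) (hR : 0 ≤ R) (hw : 0 ≤ w) (hr : 0 ≤ r) (hδ₁ : 0 < δ₁)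
    (hδ₂ : 0 < δ₂) (h₁ : δ₁ * (1 + r) ≤ ‖d₁‖) (h₂ : δ₂ ≤ ‖d₂‖) (hr₁ : ‖d₁ - 1‖ = r) :
    ‖((Real.exp (-(x + y) - (P + Q + R)) : ℝ) : ℂ) * ((w : ℂ) / (d₁ * d₂))
        - ((Real.exp (-(x + y)) : ℝ) : ℂ) * ((w : ℂ) / (d₁ * d₂))
        + (((1 - Real.exp (-Q)) * Real.exp (-y) * w : ℝ) : ℂ) / d₂‖
      ≤ 1 / (δ₁ * δ₂) * (w * (Real.exp (-(x + y)) * (P + (1 - Real.exp (-R)))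
        + (1 - Real.exp (-Q)) * Real.exp (-y) * ((1 - Real.exp (-x)) + min 1 r))) := by
  have hd₁ : d₁ ≠ 0 := norm_pos_iff.1 ((by positivity : 0 < δ₁ * (1 + r)).trans_le h₁)
  have hd₂ : d₂ ≠ 0 := norm_pos_iff.1 (hδ₂.trans_le h₂)
  have hxn := one_sub_exp_neg_nonneg hx
  have hQn := one_sub_exp_neg_nonneg hQ
  have hRn := one_sub_exp_neg_nonneg hR
  set S : ℝ := Real.exp (-(x + y)) * Real.exp (-Q) * (1 - Real.exp (-(P + R))) with hS
  set T : ℝ := (1 - Real.exp (-Q)) * Real.exp (-y) with hT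
  have hPR := one_sub_exp_neg_nonneg (add_nonneg hP hR)
  have hS0 : 0 ≤ S := by positivity
  have hT0 : 0 ≤ T := by positivity
  -- Over the common denominator the last term becomes `T d₁`, and `d₁ = e^{-x} + (1 - e^{-x}) + (d₁
  -- - 1)`. The `e^{-x}` part cancels the effect of `Q`, leaving `-S`.
  have hid : ((Real.exp (-(x + y) - (P + Q + R)) : ℝ) : ℂ) * ((w : ℂ) / (d₁ * d₂))
        - ((Real.exp (-(x + y)) : ℝ) : ℂ) * ((w : ℂ) / (d₁ * d₂))
        + ((T * w : ℝ) : ℂ) / d₂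
      = (w : ℂ) / (d₁ * d₂) * (((-S : ℝ) : ℂ)
        + (T : ℂ) * (((1 - Real.exp (-x) : ℝ) : ℂ) + (d₁ - 1))) := by
    have e1 : Real.exp (-(x + y) - (P + Q + R))
        = Real.exp (-x) * Real.exp (-y) * Real.exp (-P) * Real.exp (-Q) * Real.exp (-R) := by
      simp only [← Real.exp_add]; ring_nf
    have e2 : Real.exp (-(x + y)) = Real.exp (-x) * Real.exp (-y) := by
      simp only [← Real.exp_add]; ring_nf
    have e3 : Real.exp (-(P + R)) = Real.exp (-P) * Real.exp (-R) := by
      simp only [← Real.exp_add]; ring_nf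
    rw [hS, hT, e1, e2, e3]
    push_cast
    field_simp
    ring
  rw [hid, norm_mul, norm_div, norm_mul, Complex.norm_of_nonneg hw]
  have hn : ‖((-S : ℝ) : ℂ) + (T : ℂ) * (((1 - Real.exp (-x) : ℝ) : ℂ) + (d₁ - 1))‖
      ≤ S + T * ((1 - Real.exp (-x)) + r) := by
    refine (norm_add_le _ _).trans (add_le_add ?_ ?_)
    · rw [Complex.ofReal_neg, norm_neg, Complex.norm_of_nonneg hS0]
    · rw [norm_mul, Complex.norm_of_nonneg hT0]
      refine mul_le_mul_of_nonneg_left ((norm_add_le _ _).trans ?_) hT0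
      rw [Complex.norm_of_nonneg hxn, hr₁]
  have hS1 : S ≤ Real.exp (-(x + y)) * (P + (1 - Real.exp (-R))) := by
    rw [hS, mul_assoc]
    refine mul_le_mul_of_nonneg_left ?_ (Real.exp_pos _).le
    refine (mul_le_of_le_one_left hPR (Real.exp_le_one_iff.2 (by linarith))).trans ?_
    linarith [one_sub_exp_neg_add_le hP hR, one_sub_exp_neg_le P]
  -- The growth of `d₁` is needed here: a constant lower bound would leave `r`, unbounded as `u₁ →
  -- ∞`.
  have hmin : r / (1 + r) ≤ min 1 r := by
    refine le_min ?_ ?_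
    · rw [div_le_one (by positivity)]; linarith
    · exact div_le_self hr (by linarith)
  have hdiv : (S + T * ((1 - Real.exp (-x)) + r)) / (1 + r)
      ≤ Real.exp (-(x + y)) * (P + (1 - Real.exp (-R)))
        + T * ((1 - Real.exp (-x)) + min 1 r) := by
    rw [add_div, mul_div_assoc T, add_div]
    refine add_le_add ((div_le_self hS0 (by linarith)).trans hS1)
      (mul_le_mul_of_nonneg_left (add_le_add (div_le_self hxn (by linarith)) hmin) hT0)
  calc w / (‖d₁‖ * ‖d₂‖) * ‖((-S : ℝ) : ℂ) + (T : ℂ) * (((1 - Real.exp (-x) : ℝ) : ℂ) + (d₁ - 1))‖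
      ≤ w / (δ₁ * (1 + r) * δ₂) * (S + T * ((1 - Real.exp (-x)) + r)) := by gcongr
    _ = 1 / (δ₁ * δ₂) * (w * ((S + T * ((1 - Real.exp (-x)) + r)) / (1 + r))) := by
        field_simp
    _ ≤ _ := by gcongr

/-! ### The remainder majorant and its integral -/

/-- An integrable majorant of the remainder of the expansion, of total mass `O(ε ^ β)`. -/
noncomputable def remainderMajorant (X Y Z α β ε : ℝ) (p : ℝ × ℝ) : ℝ :=
  2 * ε * (gammaKernel α (X / 2) p.1 * gammaKernel β (Y / 2) p.2)
    + gammaKernel α X p.1 * cutoffKernel β (ε * Y) p.2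
    + (2 + X + Z) * (cutoffKernel β (ε * X) p.1 * (gammaKernel β Y p.2 + gammaKernel (β + 1) Y p.2)
      + (1 + 1 / Y) * (min 1 (Real.exp p.1) * Real.exp (-((β - α) * p.1))
        * cutoffKernel β (ε * Z) (p.1 + p.2)))

/-- The shear `(u₁, u₂) ↦ (u₁, u₁ + u₂)` preserves Lebesgue measure; it decouples the `Z` term. -/
theorem integrable_mul_comp_add {f g : ℝ → ℝ} (hf : Integrable f) (hg : Integrable g) :
    Integrable (fun p : ℝ × ℝ => f p.1 * g (p.1 + p.2)) (volume.prod volume) :=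
  (measurePreserving_prod_add (volume : Measure ℝ) (volume : Measure ℝ)).integrable_comp_of_integrable
    (hf.mul_prod hg)

theorem integral_mul_comp_add (f g : ℝ → ℝ) :
    ∫ p : ℝ × ℝ, f p.1 * g (p.1 + p.2) ∂(volume.prod volume) = (∫ x, f x) * ∫ x, g x := by
  rw [← integral_prod_mul]
  exact (measurePreserving_prod_add (volume : Measure ℝ) (volume : Measure ℝ)).integral_comp
    (MeasurableEquiv.shearAddRight ℝ).measurableEmbedding (fun q : ℝ × ℝ => f q.1 * g q.2)

theorem integral_add_add_mul_add {Ω : Type*} [MeasurableSpace Ω] {μ : Measure Ω}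
    {f₁ f₂ f₃ f₄ : Ω → ℝ} {a b c : ℝ} (h₁ : Integrable f₁ μ) (h₂ : Integrable f₂ μ)
    (h₃ : Integrable f₃ μ) (h₄ : Integrable f₄ μ) :
    ∫ p, (a * f₁ p + f₂ p + b * (f₃ p + c * f₄ p)) ∂μ
      = a * (∫ p, f₁ p ∂μ) + (∫ p, f₂ p ∂μ) + b * ((∫ p, f₃ p ∂μ) + c * ∫ p, f₄ p ∂μ) := by
  rw [← integral_const_mul a, ← integral_const_mul c, ← integral_add h₃ (h₄.const_mul c),
    ← integral_const_mul b, ← integral_add (h₁.const_mul a) h₂]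
  exact integral_add ((h₁.const_mul a).add h₂) ((h₃.add (h₄.const_mul c)).const_mul b)

theorem integrable_remainderMajorant {X Y Z α β ε : ℝ} (hX : 0 < X) (hY : 0 < Y) (hZ : 0 < Z)
    (hα : 0 < α) (hαβ : α < β) (hβ : β < 1) (hε : 0 < ε) :
    Integrable (remainderMajorant X Y Z α β ε) (volume.prod volume) := by
  have hβ0 := hα.trans hαβ
  unfold remainderMajorant
  refine ((((integrable_gammaKernel hα (by positivity)).mul_prod
    (integrable_gammaKernel hβ0 (by positivity))).const_mul _).add
    ((integrable_gammaKernel hα hX).mul_prod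
      (integrable_cutoffKernel hβ0 hβ (by positivity)))).add
    (Integrable.const_mul (Integrable.add ?_ (Integrable.const_mul ?_ _)) _)
  · exact (integrable_cutoffKernel hβ0 hβ (by positivity)).mul_prod
      ((integrable_gammaKernel hβ0 hY).add (integrable_gammaKernel (by linarith) hY))
  · exact integrable_mul_comp_add (integrable_min_one_exp_mul (by linarith) (by linarith))
      (integrable_cutoffKernel hβ0 hβ (by positivity))

theorem integral_remainderMajorant {X Y Z α β ε : ℝ} (hX : 0 < X) (hY : 0 < Y) (hZ : 0 < Z)
    (hα : 0 < α) (hαβ : α < β) (hβ : β < 1) (hε : 0 < ε) :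
    ∫ p, remainderMajorant X Y Z α β ε p ∂(volume.prod volume)
      = ε * (2 * ((∫ u, gammaKernel α (X / 2) u) * ∫ u, gammaKernel β (Y / 2) u))
        + ε ^ β * (-Real.Gamma (-β) * ((∫ u, gammaKernel α X u) * Y ^ β
          + (2 + X + Z) * (X ^ β * (∫ u, (gammaKernel β Y u + gammaKernel (β + 1) Y u))
            + (1 + 1 / Y) * ((∫ u, min 1 (Real.exp u) * Real.exp (-((β - α) * u))) * Z ^ β)))) := by
  have hβ0 := hα.trans hαβ
  have i1 := ((integrable_gammaKernel hα (by positivity : 0 < X / 2)).mul_prod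
    (integrable_gammaKernel hβ0 (by positivity : 0 < Y / 2)))
  have i2 := (integrable_gammaKernel hα hX).mul_prod
      (integrable_cutoffKernel hβ0 hβ (by positivity : 0 ≤ ε * Y))
  have i3 := (integrable_cutoffKernel hβ0 hβ (by positivity : 0 ≤ ε * X)).mul_prod
    (g := fun u => gammaKernel β Y u + gammaKernel (β + 1) Y u)
      ((integrable_gammaKernel hβ0 hY).add (integrable_gammaKernel (s := β + 1) (by linarith) hY))
  have i4 := integrable_mul_comp_add
    (integrable_min_one_exp_mul (s := β - α) (by linarith) (by linarith))
      (integrable_cutoffKernel hβ0 hβ (by positivity : 0 ≤ ε * Z))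
  unfold remainderMajorant
  rw [integral_add_add_mul_add i1 i2 i3 i4,
    integral_mul_comp_add (fun u => min 1 (Real.exp u) * Real.exp (-((β - α) * u))),
    integral_prod_mul,
    integral_prod_mul, integral_prod_mul (μ := volume) (ν := volume) (cutoffKernel β (ε * X))
      (fun u => gammaKernel β Y u + gammaKernel (β + 1) Y u),
    integral_cutoffKernel hβ0 hβ (by positivity), integral_cutoffKernel hβ0 hβ (by positivity),
    integral_cutoffKernel hβ0 hβ (by positivity), Real.mul_rpow hε.le hX.le,
    Real.mul_rpow hε.le hY.le, Real.mul_rpow hε.le hZ.le]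
  ring

theorem le_remainderMajorant {X Y Z α β ε : ℝ} (hX : 0 < X) (hY : 0 < Y) (hZ : 0 < Z)
    (hα : 0 < α) (hαβ : α < β) (hβ : β < 1) (hε : 0 < ε) (u₁ u₂ : ℝ) :
    Real.exp (α * u₁ + β * u₂)
      * (Real.exp (-(X * Real.exp u₁ + Z * Real.exp (u₁ + u₂) + Y * Real.exp u₂))
          * (ε * (X * Real.exp u₁ + Z * Real.exp (u₁ + u₂) + Y * Real.exp u₂)
            + (1 - Real.exp (-(ε * Y * Real.exp (-u₂)))))
        + (1 - Real.exp (-(ε * (X + Z * Real.exp (-u₂)) * Real.exp (-u₁))))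
          * Real.exp (-(Y * Real.exp u₂))
          * ((1 - Real.exp (-(X * Real.exp u₁ + Z * Real.exp (u₁ + u₂))))
            + min 1 (Real.exp u₁)))
      ≤ remainderMajorant X Y Z α β ε (u₁, u₂) := by
  have ew : Real.exp (α * u₁ + β * u₂) = Real.exp (α * u₁) * Real.exp (β * u₂) := Real.exp_add _ _
  set A := X * Real.exp u₁ + Z * Real.exp (u₁ + u₂) + Y * Real.exp u₂ with hA
  have hA0 : 0 ≤ A := by positivity
  have hAle : X * Real.exp u₁ + Y * Real.exp u₂ ≤ A := by
    have : 0 ≤ Z * Real.exp (u₁ + u₂) := by positivity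
    linarith
  have hm0 : 0 < min 1 (Real.exp u₁) := lt_min one_pos (Real.exp_pos _)
  have hR0 := one_sub_exp_neg_nonneg (by positivity : 0 ≤ ε * Y * Real.exp (-u₂))
  have t1 : Real.exp (α * u₁ + β * u₂) * (Real.exp (-A) * (ε * A))
      ≤ 2 * ε * (gammaKernel α (X / 2) u₁ * gammaKernel β (Y / 2) u₂) := by
    -- Half of the exponential decay absorbs the factor `A`; hence `X / 2` and `Y / 2` in the
    -- majorant.
    have h1 : A * Real.exp (-A) ≤ 2 * Real.exp (-(A / 2)) := by
      have h2 : A ≤ 2 * Real.exp (A / 2) := by linarith [Real.add_one_le_exp (A / 2)]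
      calc A * Real.exp (-A) ≤ 2 * Real.exp (A / 2) * Real.exp (-A) := by gcongr
        _ = 2 * Real.exp (-(A / 2)) := by rw [mul_assoc, ← Real.exp_add]; ring_nf
    have h3 : Real.exp (-(A / 2))
        ≤ Real.exp (-(X / 2 * Real.exp u₁)) * Real.exp (-(Y / 2 * Real.exp u₂)) := by
      rw [← Real.exp_add]
      exact Real.exp_le_exp.2 (by linarith)
    calc Real.exp (α * u₁ + β * u₂) * (Real.exp (-A) * (ε * A))
        = ε * Real.exp (α * u₁ + β * u₂) * (A * Real.exp (-A)) := by ring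
      _ ≤ ε * Real.exp (α * u₁ + β * u₂)
          * (2 * (Real.exp (-(X / 2 * Real.exp u₁)) * Real.exp (-(Y / 2 * Real.exp u₂)))) := by
        refine mul_le_mul_of_nonneg_left ?_ (by positivity)
        exact h1.trans (mul_le_mul_of_nonneg_left h3 zero_le_two)
      _ = _ := by rw [ew]; unfold gammaKernel; ring
  have t2 : Real.exp (α * u₁ + β * u₂)
        * (Real.exp (-A) * (1 - Real.exp (-(ε * Y * Real.exp (-u₂)))))
      ≤ gammaKernel α X u₁ * cutoffKernel β (ε * Y) u₂ := by
    have h1 : Real.exp (-A) ≤ Real.exp (-(X * Real.exp u₁)) :=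
      Real.exp_le_exp.2 (by have : 0 ≤ Y * Real.exp u₂ := by positivity
                            linarith)
    calc _ ≤ Real.exp (α * u₁ + β * u₂)
        * (Real.exp (-(X * Real.exp u₁)) * (1 - Real.exp (-(ε * Y * Real.exp (-u₂))))) := by gcongr
      _ = _ := by rw [ew]; unfold gammaKernel cutoffKernel; ring
  set qa := 1 - Real.exp (-(ε * X * Real.exp (-u₁))) with hqa
  set qb := 1 - Real.exp (-(ε * Z * Real.exp (-(u₁ + u₂)))) with hqb
  have hqa0 : 0 ≤ qa := one_sub_exp_neg_nonneg (by positivity)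
  have hqb0 : 0 ≤ qb := one_sub_exp_neg_nonneg (by positivity)
  -- Subadditivity of `1 - e^{-t}` separates the cutoff in `u₁` from the cutoff in `u₁ + u₂`.
  have hq : 1 - Real.exp (-(ε * (X + Z * Real.exp (-u₂)) * Real.exp (-u₁))) ≤ qa + qb := by
    have h1 := one_sub_exp_neg_add_le (by positivity : 0 ≤ ε * X * Real.exp (-u₁))
      (by positivity : 0 ≤ ε * Z * Real.exp (-(u₁ + u₂)))
    refine le_trans (le_of_eq ?_) h1
    rw [neg_add u₁, Real.exp_add]
    ring_nf
  have hbr : (1 - Real.exp (-(X * Real.exp u₁ + Z * Real.exp (u₁ + u₂)))) + min 1 (Real.exp u₁)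
      ≤ (2 + X + Z) * ((1 + Real.exp u₂) * min 1 (Real.exp u₁)) := by
    have h1 := one_sub_exp_neg_le_one (X * Real.exp u₁ + Z * Real.exp (u₁ + u₂))
    have h2 := one_sub_exp_neg_le (X * Real.exp u₁ + Z * Real.exp (u₁ + u₂))
    have e2 := Real.exp_pos u₂
    have e1 := Real.exp_pos u₁
    rw [Real.exp_add] at h1 h2 ⊢
    have hXe := mul_pos hX e2
    have hZe := mul_pos hZ e2
    rcases min_cases 1 (Real.exp u₁) with ⟨h, _⟩ | ⟨h, _⟩ <;> rw [h]
    · nlinarith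
    · have : X * Real.exp u₁ + Z * (Real.exp u₁ * Real.exp u₂) + Real.exp u₁
          ≤ (2 + X + Z) * ((1 + Real.exp u₂) * Real.exp u₁) := by
        have : 0 ≤ Real.exp u₁ * (1 + 2 * Real.exp u₂ + X * Real.exp u₂ + Z) := by positivity
        linarith
      linarith
  have ta : Real.exp (α * u₁ + β * u₂)
        * (qa * Real.exp (-(Y * Real.exp u₂)) * ((1 + Real.exp u₂) * min 1 (Real.exp u₁)))
      ≤ cutoffKernel β (ε * X) u₁ * (gammaKernel β Y u₂ + gammaKernel (β + 1) Y u₂) := by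
    -- The gain from `ε^α` to `ε^β`: it holds because `α ≤ β ≤ α + 1`.
    have h1 : Real.exp (α * u₁) * min 1 (Real.exp u₁) ≤ Real.exp (β * u₁) := by
      rcases le_total u₁ 0 with h | h
      · refine (mul_le_mul_of_nonneg_left (min_le_right _ _) (Real.exp_pos _).le).trans ?_
        rw [← Real.exp_add]
        exact Real.exp_le_exp.2 (by nlinarith)
      · refine (mul_le_mul_of_nonneg_left (min_le_left _ _) (Real.exp_pos _).le).trans ?_
        rw [mul_one]
        exact Real.exp_le_exp.2 (by nlinarith)
    have h2 : Real.exp ((β + 1) * u₂) = Real.exp (β * u₂) * Real.exp u₂ := by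
      rw [← Real.exp_add]; ring_nf
    calc _ = qa * Real.exp (-(Y * Real.exp u₂)) * (1 + Real.exp u₂) * Real.exp (β * u₂)
          * (Real.exp (α * u₁) * min 1 (Real.exp u₁)) := by rw [ew]; ring
      _ ≤ qa * Real.exp (-(Y * Real.exp u₂)) * (1 + Real.exp u₂) * Real.exp (β * u₂)
          * Real.exp (β * u₁) := by gcongr
      _ = _ := by unfold gammaKernel cutoffKernel; rw [h2, ← hqa]; ring
  have tb : Real.exp (α * u₁ + β * u₂)
        * (qb * Real.exp (-(Y * Real.exp u₂)) * ((1 + Real.exp u₂) * min 1 (Real.exp u₁)))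
      ≤ (1 + 1 / Y) * (min 1 (Real.exp u₁) * Real.exp (-((β - α) * u₁))
        * cutoffKernel β (ε * Z) (u₁ + u₂)) := by
    have h1 : Real.exp (-(Y * Real.exp u₂)) * (1 + Real.exp u₂) ≤ 1 + 1 / Y := by
      have h2 : Real.exp (-(Y * Real.exp u₂)) ≤ 1 := Real.exp_le_one_iff.2 (by
        have : 0 ≤ Y * Real.exp u₂ := by positivity
        linarith)
      have h3 : Real.exp (-(Y * Real.exp u₂)) * Real.exp u₂ ≤ 1 / Y := by
        rw [le_div_iff₀ hY, Real.exp_neg, mul_assoc, inv_mul_le_iff₀ (Real.exp_pos _)]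
        linarith [Real.add_one_le_exp (Y * Real.exp u₂)]
      linarith
    -- In sheared coordinates the cutoff variable carries the full exponent `β`; the leftover
    -- `e^{-(β-α)u₁}` is integrable against `min(1, e^{u₁})` since `0 < β - α < 1`.
    have h2 : Real.exp (α * u₁ + β * u₂)
        = Real.exp (-((β - α) * u₁)) * Real.exp (β * (u₁ + u₂)) := by
      rw [← Real.exp_add]; ring_nf
    calc _ = (Real.exp (-(Y * Real.exp u₂)) * (1 + Real.exp u₂))
          * (Real.exp (α * u₁ + β * u₂) * qb * min 1 (Real.exp u₁)) := by ring
      _ ≤ (1 + 1 / Y) * (Real.exp (α * u₁ + β * u₂) * qb * min 1 (Real.exp u₁)) := by gcongr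
      _ = _ := by unfold cutoffKernel; rw [h2, ← hqb]; ring
  have tq : Real.exp (α * u₁ + β * u₂)
      * ((1 - Real.exp (-(ε * (X + Z * Real.exp (-u₂)) * Real.exp (-u₁))))
          * Real.exp (-(Y * Real.exp u₂))
          * ((1 - Real.exp (-(X * Real.exp u₁ + Z * Real.exp (u₁ + u₂))))
            + min 1 (Real.exp u₁)))
      ≤ (2 + X + Z) * (Real.exp (α * u₁ + β * u₂)
        * (qa * Real.exp (-(Y * Real.exp u₂)) * ((1 + Real.exp u₂) * min 1 (Real.exp u₁)))
        + Real.exp (α * u₁ + β * u₂)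
        * (qb * Real.exp (-(Y * Real.exp u₂)) * ((1 + Real.exp u₂) * min 1 (Real.exp u₁)))) := by
    have hx0 := one_sub_exp_neg_nonneg
      (by positivity : 0 ≤ X * Real.exp u₁ + Z * Real.exp (u₁ + u₂))
    calc _ ≤ Real.exp (α * u₁ + β * u₂) * ((qa + qb) * Real.exp (-(Y * Real.exp u₂))
          * ((2 + X + Z) * ((1 + Real.exp u₂) * min 1 (Real.exp u₁)))) := by gcongr
      _ = _ := by ring
  have tab := mul_le_mul_of_nonneg_left (add_le_add ta tb) (by positivity : 0 ≤ 2 + X + Z)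
  simp only [remainderMajorant]
  linarith

/-! ### The integrands and the leading kernel -/

theorem integrandV_eq (X Y Z α β φ₁ φ₂ ε u₁ u₂ : ℝ) :
    integrandV X Y Z α β φ₁ φ₂ ε u₁ u₂
      = ((Real.exp (-((X * Real.exp u₁ + Z * Real.exp (u₁ + u₂)) + Y * Real.exp u₂)
          - (ε * ((X * Real.exp u₁ + Z * Real.exp (u₁ + u₂)) + Y * Real.exp u₂)
            + ε * (X + Z * Real.exp (-u₂)) * Real.exp (-u₁)
            + ε * Y * Real.exp (-u₂))) : ℝ) : ℂ)
        * (((Real.exp (α * u₁ + β * u₂) : ℝ) : ℂ)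
          / ((1 + Complex.exp (u₁ + Complex.I * φ₁)) * (1 + Complex.exp (u₂ + Complex.I * φ₂)))) := by
  unfold integrandV
  congr 3
  rw [Real.cosh_eq, Real.cosh_eq, Real.cosh_eq, neg_add u₁ u₂, Real.exp_add (-u₁) (-u₂)]
  ring

theorem integrandV_zero (X Y Z α β φ₁ φ₂ u₁ u₂ : ℝ) :
    integrandV X Y Z α β φ₁ φ₂ 0 u₁ u₂
      = ((Real.exp (-((X * Real.exp u₁ + Z * Real.exp (u₁ + u₂)) + Y * Real.exp u₂)) : ℝ) : ℂ)
        * (((Real.exp (α * u₁ + β * u₂) : ℝ) : ℂ)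
          / ((1 + Complex.exp (u₁ + Complex.I * φ₁)) * (1 + Complex.exp (u₂ + Complex.I * φ₂)))) := by
  rw [integrandV_eq]
  simp

/-- The leading part of `V(ε) - V(0)` for small `ε`. -/
noncomputable def leadingKernel (X Y Z α β φ ε u₁ u₂ : ℝ) : ℂ :=
  ((-cutoffKernel α (ε * (X + Z * Real.exp (-u₂))) u₁ : ℝ) : ℂ)
    * (((gammaKernel β Y u₂ : ℝ) : ℂ) / (1 + Complex.exp (u₂ + Complex.I * φ)))

theorem continuous_integrandV (X Y Z α β ε : ℝ) {φ₁ φ₂ : ℝ}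
    (hφ₁ : φ₁ ∈ Ioo (-Real.pi) Real.pi) (hφ₂ : φ₂ ∈ Ioo (-Real.pi) Real.pi) :
    Continuous (fun u : ℝ × ℝ => integrandV X Y Z α β φ₁ φ₂ ε u.1 u.2) := by
  unfold integrandV
  refine Continuous.mul (by fun_prop) (Continuous.div (by fun_prop) (by fun_prop) fun p => ?_)
  exact mul_ne_zero (one_add_exp_ne_zero hφ₁ _) (one_add_exp_ne_zero hφ₂ _)

theorem continuous_leadingKernel (X Y Z α β ε : ℝ) {φ : ℝ} (hφ : φ ∈ Ioo (-Real.pi) Real.pi) :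
    Continuous (fun u : ℝ × ℝ => leadingKernel X Y Z α β φ ε u.1 u.2) := by
  unfold leadingKernel cutoffKernel gammaKernel
  refine Continuous.mul (by fun_prop) (Continuous.div (by fun_prop) (by fun_prop) fun p => ?_)
  exact one_add_exp_ne_zero hφ _

theorem continuous_integrandS {X Y Z α β φ : ℝ} (hX : 0 < X) (hZ : 0 < Z)
    (hφ : φ ∈ Ioo (-Real.pi) Real.pi) : Continuous (integrandS X Y Z α β φ) := by
  unfold integrandS
  refine Continuous.mul (Complex.continuous_ofReal.comp (Continuous.mul ?_ (by fun_prop)))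
    (Continuous.div (by fun_prop) (by fun_prop) fun p => one_add_exp_ne_zero hφ _)
  exact Continuous.rpow_const (by fun_prop) fun u => Or.inl (by positivity)

theorem integrable_integrandV {X Y Z α β φ₁ φ₂ ε : ℝ} (hX : 0 < X) (hY : 0 < Y) (hZ : 0 < Z)
    (hα : 0 < α) (hβ : 0 < β) (hφ₁ : φ₁ ∈ Ioo (-Real.pi) Real.pi)
    (hφ₂ : φ₂ ∈ Ioo (-Real.pi) Real.pi) (hε : 0 ≤ ε) :
    Integrable (fun u : ℝ × ℝ => integrandV X Y Z α β φ₁ φ₂ ε u.1 u.2)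
      (volume.prod volume) := by
  refine (((integrable_gammaKernel hα hX).mul_prod (integrable_gammaKernel hβ hY)).div_const
    (Real.cos (φ₁ / 2) * Real.cos (φ₂ / 2))).mono'
    (continuous_integrandV X Y Z α β ε hφ₁ hφ₂).aestronglyMeasurable (ae_of_all _ fun p => ?_)
  have c₁ := cos_half_pos_of_mem_Ioo hφ₁
  have c₂ := cos_half_pos_of_mem_Ioo hφ₂
  rw [integrandV_eq, norm_mul, norm_div, norm_mul, Complex.norm_of_nonneg (Real.exp_pos _).le,
    Complex.norm_of_nonneg (Real.exp_pos _).le, ← mul_div_assoc]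
  refine div_le_div₀ (mul_nonneg (gammaKernel_nonneg _ _ _) (gammaKernel_nonneg _ _ _)) ?_
    (mul_pos c₁ c₂) (mul_le_mul (cos_half_le_norm_one_add_exp hφ₁ _)
      (cos_half_le_norm_one_add_exp hφ₂ _) c₂.le (norm_nonneg _))
  simp only [gammaKernel, ← Real.exp_add]
  refine Real.exp_le_exp.2 ?_
  have h1 : 0 ≤ Z * Real.exp (p.1 + p.2) := by positivity
  have h2 : 0 ≤ ε * (X * Real.exp p.1 + Z * Real.exp (p.1 + p.2) + Y * Real.exp p.2)
    + ε * (X + Z * Real.exp (-p.2)) * Real.exp (-p.1) + ε * Y * Real.exp (-p.2) := by positivity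
  linarith

/-- Subadditivity of `t^α` splits the power; its `Z` part lowers the exponent to `β - α`, which is
still positive. -/
theorem integrable_integrandS {X Y Z α β φ : ℝ} (hX : 0 < X) (hY : 0 < Y) (hZ : 0 < Z)
    (hα : 0 < α) (hα1 : α < 1) (hαβ : α < β) (hφ : φ ∈ Ioo (-Real.pi) Real.pi) :
    Integrable (integrandS X Y Z α β φ) := by
  refine (((((integrable_gammaKernel (hα.trans hαβ) hY).const_mul (X ^ α))).add
    ((integrable_gammaKernel (s := β - α) (by linarith) hY).const_mul (Z ^ α))).div_const
    (Real.cos (φ / 2))).mono' (continuous_integrandS hX hZ hφ).aestronglyMeasurable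
    (ae_of_all _ fun u => ?_)
  have c := cos_half_pos_of_mem_Ioo hφ
  have hW : 0 < X + Z * Real.exp (-u) := by positivity
  rw [integrandS, norm_mul, norm_div, Complex.norm_of_nonneg (by positivity),
    Complex.norm_of_nonneg (Real.exp_pos _).le, ← mul_div_assoc]
  refine div_le_div₀ (add_nonneg (mul_nonneg (by positivity) (gammaKernel_nonneg _ _ _))
    (mul_nonneg (by positivity) (gammaKernel_nonneg _ _ _))) ?_ c
    (cos_half_le_norm_one_add_exp hφ _)
  have h1 : (X + Z * Real.exp (-u)) ^ α ≤ X ^ α + Z ^ α * Real.exp (-(α * u)) := by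
    refine (Real.rpow_add_le_add_rpow hX.le (by positivity) hα.le hα1.le).trans (le_of_eq ?_)
    rw [Real.mul_rpow hZ.le (Real.exp_pos _).le, ← Real.exp_mul]
    ring_nf
  have h2 : Real.exp ((β - α) * u) = Real.exp (-(α * u)) * Real.exp (β * u) := by
    rw [← Real.exp_add]; ring_nf
  calc _ ≤ (X ^ α + Z ^ α * Real.exp (-(α * u))) * Real.exp (-(Y * Real.exp u))
        * Real.exp (β * u) := by gcongr
    _ = _ := by simp only [gammaKernel, Pi.add_apply, h2]; ring

theorem integral_leadingKernel {X Y Z α β φ ε : ℝ} (hX : 0 < X) (hZ : 0 < Z)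
    (hα : 0 < α) (hα1 : α < 1) (hε : 0 < ε) :
    ∫ u₂ : ℝ, ∫ u₁ : ℝ, leadingKernel X Y Z α β φ ε u₁ u₂
      = ((Real.Gamma (-α) * ε ^ α : ℝ) : ℂ) * ∫ u : ℝ, integrandS X Y Z α β φ u := by
  rw [← integral_const_mul]
  congr 1 with u
  have hW : 0 < X + Z * Real.exp (-u) := by positivity
  unfold leadingKernel
  rw [integral_mul_const, integral_complex_ofReal, integral_neg,
    integral_cutoffKernel hα hα1 (by positivity), Real.mul_rpow hε.le hW.le, integrandS,
    gammaKernel]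
  push_cast
  ring

theorem norm_integrandV_sub_sub_leadingKernel_le {X Y Z α β φ₁ φ₂ ε : ℝ} (hX : 0 < X)
    (hY : 0 < Y) (hZ : 0 < Z) (hα : 0 < α) (hαβ : α < β) (hβ : β < 1)
    (hφ₁ : φ₁ ∈ Ioo (-Real.pi) Real.pi) (hφ₂ : φ₂ ∈ Ioo (-Real.pi) Real.pi) (hε : 0 < ε)
    (u₁ u₂ : ℝ) :
    ‖integrandV X Y Z α β φ₁ φ₂ ε u₁ u₂ - integrandV X Y Z α β φ₁ φ₂ 0 u₁ u₂
        - leadingKernel X Y Z α β φ₂ ε u₁ u₂‖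
      ≤ 1 / (Real.cos (φ₁ / 2) * Real.cos (φ₂ / 2))
        * remainderMajorant X Y Z α β ε (u₁, u₂) := by
  have c₁ := cos_half_pos_of_mem_Ioo hφ₁
  have c₂ := cos_half_pos_of_mem_Ioo hφ₂
  have key := norm_damped_sub_le (x := X * Real.exp u₁ + Z * Real.exp (u₁ + u₂))
    (y := Y * Real.exp u₂)
    (P := ε * ((X * Real.exp u₁ + Z * Real.exp (u₁ + u₂)) + Y * Real.exp u₂))
    (Q := ε * (X + Z * Real.exp (-u₂)) * Real.exp (-u₁)) (R := ε * Y * Real.exp (-u₂))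
    (w := Real.exp (α * u₁ + β * u₂)) (by positivity) (by positivity) (by positivity)
    (by positivity) (by positivity) (Real.exp_pos u₁).le c₁ c₂
    (cos_half_mul_le_norm_one_add_exp φ₁ u₁) (cos_half_le_norm_one_add_exp hφ₂ u₂)
    (norm_exp_add_I_mul φ₁ u₁)
  have hM : leadingKernel X Y Z α β φ₂ ε u₁ u₂
      = -((((1 - Real.exp (-(ε * (X + Z * Real.exp (-u₂)) * Real.exp (-u₁))))
        * Real.exp (-(Y * Real.exp u₂)) * Real.exp (α * u₁ + β * u₂) : ℝ) : ℂ)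
          / (1 + Complex.exp (u₂ + Complex.I * φ₂))) := by
    unfold leadingKernel cutoffKernel gammaKernel
    rw [Real.exp_add (α * u₁)]
    push_cast
    ring
  rw [hM, sub_neg_eq_add, integrandV_zero, integrandV_eq]
  exact key.trans (mul_le_mul_of_nonneg_left
    (le_remainderMajorant hX hY hZ hα hαβ hβ hε u₁ u₂) (by positivity))

/-! ### The asymptotic expansion -/

theorem mainTheorem4 (X Y Z α β φ₁ φ₂ : ℝ) (hX : 0 < X) (hY : 0 < Y) (hZ : 0 < Z)
    (hα : 0 < α) (hαβ : α < β) (hβ : β < 1)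
    (hφ₁ : φ₁ ∈ Set.Ioo (-Real.pi) Real.pi) (hφ₂ : φ₂ ∈ Set.Ioo (-Real.pi) Real.pi) :
    (∀ ε : ℝ, 0 ≤ ε →
      MeasureTheory.Integrable
        (fun u : ℝ × ℝ => integrandV X Y Z α β φ₁ φ₂ ε u.1 u.2) MeasureTheory.volume) ∧
    MeasureTheory.Integrable (fun u : ℝ => integrandS X Y Z α β φ₂ u) MeasureTheory.volume ∧
    Asymptotics.IsBigO (nhdsWithin (0 : ℝ) (Set.Ioi 0))
      (fun ε : ℝ =>
        (∫ u₂ : ℝ, ∫ u₁ : ℝ, integrandV X Y Z α β φ₁ φ₂ ε u₁ u₂)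
          - ((∫ u₂ : ℝ, ∫ u₁ : ℝ, integrandV X Y Z α β φ₁ φ₂ 0 u₁ u₂)
            + ((Real.Gamma (-α) * ε ^ α : ℝ) : ℂ) * ∫ u : ℝ, integrandS X Y Z α β φ₂ u))
      (fun ε : ℝ => ε ^ β) := by
  have hβ0 := hα.trans hαβ
  have hV : ∀ ε : ℝ, 0 ≤ ε → Integrable
      (fun u : ℝ × ℝ => integrandV X Y Z α β φ₁ φ₂ ε u.1 u.2) (volume.prod volume) :=
    fun ε hε => integrable_integrandV hX hY hZ hα hβ0 hφ₁ hφ₂ hε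
  refine ⟨hV, integrable_integrandS hX hY hZ hα (hαβ.trans hβ) hαβ hφ₂, ?_⟩
  have c₁ := cos_half_pos_of_mem_Ioo hφ₁
  have c₂ := cos_half_pos_of_mem_Ioo hφ₂
  -- Only `K₁` needs a sign, to replace `ε` by the larger `ε^β`.
  obtain ⟨K₁, K₂, hK₁, hK⟩ : ∃ K₁ K₂ : ℝ, 0 ≤ K₁ ∧ ∀ ε : ℝ, 0 < ε →
      ∫ p, remainderMajorant X Y Z α β ε p ∂(volume.prod volume) = ε * K₁ + ε ^ β * K₂ :=
    ⟨_, _, mul_nonneg zero_le_two (mul_nonneg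
      (integral_nonneg fun _ => gammaKernel_nonneg _ _ _)
      (integral_nonneg fun _ => gammaKernel_nonneg _ _ _)),
      fun ε hε => integral_remainderMajorant hX hY hZ hα hαβ hβ hε⟩
  refine Asymptotics.IsBigO.of_bound
    (1 / (Real.cos (φ₁ / 2) * Real.cos (φ₂ / 2)) * (K₁ + K₂)) ?_
  filter_upwards [Ioo_mem_nhdsGT (zero_lt_one : (0 : ℝ) < 1)] with ε hε
  have hε0 : 0 < ε := hε.1
  have hbound := norm_integrandV_sub_sub_leadingKernel_le hX hY hZ hα hαβ hβ hφ₁ hφ₂ hε0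
  have hmaj := (integrable_remainderMajorant hX hY hZ hα hαβ hβ hε0).const_mul
    (1 / (Real.cos (φ₁ / 2) * Real.cos (φ₂ / 2)))
  have hdiff := (hV ε hε0.le).sub (hV 0 le_rfl)
  have hrem : Integrable (fun u : ℝ × ℝ => integrandV X Y Z α β φ₁ φ₂ ε u.1 u.2
      - integrandV X Y Z α β φ₁ φ₂ 0 u.1 u.2 - leadingKernel X Y Z α β φ₂ ε u.1 u.2)
      (volume.prod volume) :=
    hmaj.mono' (((continuous_integrandV X Y Z α β ε hφ₁ hφ₂).sub
      (continuous_integrandV X Y Z α β 0 hφ₁ hφ₂)).sub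
      (continuous_leadingKernel X Y Z α β ε hφ₂)).aestronglyMeasurable
      (ae_of_all _ fun p => hbound p.1 p.2)
  -- Integrability comes for free: the leading kernel is `V(ε) - V(0)` minus the dominated
  -- remainder.
  have hlead : Integrable (fun u : ℝ × ℝ => leadingKernel X Y Z α β φ₂ ε u.1 u.2)
      (volume.prod volume) := by
    refine (hdiff.sub hrem).congr (ae_of_all _ fun p => ?_)
    simp
  rw [← integral_leadingKernel hX hZ hα (hαβ.trans hβ) hε0,
    ← integral_prod_symm (fun u : ℝ × ℝ => integrandV X Y Z α β φ₁ φ₂ ε u.1 u.2) (hV ε hε0.le),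
    ← integral_prod_symm (fun u : ℝ × ℝ => integrandV X Y Z α β φ₁ φ₂ 0 u.1 u.2) (hV 0 le_rfl),
    ← integral_prod_symm (fun u : ℝ × ℝ => leadingKernel X Y Z α β φ₂ ε u.1 u.2) hlead,
    ← sub_sub, ← integral_sub (hV ε hε0.le) (hV 0 le_rfl)]
  have hsub := integral_sub hdiff hlead
  simp only [Pi.sub_apply] at hsub
  rw [← hsub, Real.norm_of_nonneg (by positivity)]
  refine (norm_integral_le_of_norm_le hmaj (ae_of_all _ fun p => hbound p.1 p.2)).trans ?_
  rw [integral_const_mul, hK ε hε0, mul_assoc]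
  refine mul_le_mul_of_nonneg_left ?_ (by positivity)
  have hle : ε ≤ ε ^ β := by
    simpa using Real.rpow_le_rpow_of_exponent_ge hε0 hε.2.le hβ.le
  nlinarith
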